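/- Let $G$ be a real Lie group of finite dimension $n$ with Lie algebra $\mathfrak g=T_eG$, and let $\lambda_g\colon G\to G$, $\lambda_g(h)=gh$. Fix a basis $b_1,\dots,b_n$ of $\mathfrak g$. A chart $(x^i)$ of $G$ gives the *semi-invariant coordinates* $(x^i,\alpha^i)$ on $TG$: the point with coordinates $(x,\alpha)$ is the vector $\lambda_{x*}\alpha\in T_xG$, where $\alpha=\sum_i\alpha^ib_i\in\mathfrak g$. The *canonical spray* of $G$ is the vector field on $TG$ given by $S_{(x,\alpha)}=(\lambda_{x*}\alpha)\,\frac{\partial}{\partial x}$ in these coordinates; its geodesics are the left translates of the one-parameter subgroups of $G$. In the standard coordinates $(x^i,y^i)$ of $TG$ let $J=dx^i\otimes\frac{\partial}{\partial y^i}$ and $C=y^i\frac{\partial}{\partial y^i}$. The Euler–Lagrange equation associated to $S$ is $$\omega_L:=i_S\,d\,d_JL+d(CL-L)=0,\qquad d_JL=dL\circ J .$$ Let $U=TG$ or $U=TG\setminus\{0\}$, the set of nonzero tangent vectors, and let $L\colon TG\to\mathbb R$ be continuous, and smooth on $U$. Then $L$ is left invariant ($L\circ\lambda_{g*}=L$ for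 all $g\in G$) and satisfies $\omega_L=0$ on $U$ if and only if the following two conditions hold. 1. $L$ does not depend on the base point: $L(\lambda_{g*}\alpha)=L(\lambda_{h*}\alpha)$ for all $g,h\in G$ and $\alpha\in\mathfrak g$. 2. On $U$, in the semi-invariant coordinates of every smooth chart of $G$, $$[a,\alpha]^i\,\frac{\partial L}{\partial\alpha^i}=0\qquad\text{for all }a\in\mathfrak g .$$ If moreover $G$ is connected, then the same equivalence holds with condition 1 replaced by the system $$\frac{\partial L}{\partial x^i}=0,\qquad i=1,\dots,n,$$ on $U$, in the semi-invariant coordinates of every smooth chart of $G$. -/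

import Mathlib

open Set
open scoped Manifold ContDiff

noncomputable section

section LagrangianGeometry

/-! A finite-dimensional manifold `M`, modelled on `EuclideanSpace ℝ (Fin n)`.  The points of the
coordinate space of `TM` are the pairs `z = (x, y)`. -/

variable {n : ℕ} {M : Type*} [TopologicalSpace M] [ChartedSpace (EuclideanSpace ℝ (Fin n)) M]

/-- The standard coordinates `(x, y)` on `TM` induced by a chart `φ` of `M`:
`(m, v) ↦ (φ m, dφ_m v)`. -/
def tangentChart (φ : OpenPartialHomeomorph M (EuclideanSpace ℝ (Fin n)))
    (p : TangentBundle (𝓡 n) M) : EuclideanSpace ℝ (Fin n) × EuclideanSpace ℝ (Fin n) :=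
  (φ p.1, mfderiv (𝓡 n) (𝓡 n) φ p.1 p.2)

/-- The inverse of the standard coordinates on `TM`: `(x, y) ↦ (φ⁻¹ x, d(φ⁻¹)_x y)`. -/
def tangentChartInv (φ : OpenPartialHomeomorph M (EuclideanSpace ℝ (Fin n)))
    (z : EuclideanSpace ℝ (Fin n) × EuclideanSpace ℝ (Fin n)) : TangentBundle (𝓡 n) M :=
  ⟨φ.symm z.1, mfderiv (𝓡 n) (𝓡 n) φ.symm z.1 z.2⟩

/-- The vertical endomorphism `J = dxⁱ ⊗ ∂/∂yⁱ` in standard coordinates: `(X, Y) ↦ (0, X)`. -/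
def verticalEndomorphism (n : ℕ) :
    (EuclideanSpace ℝ (Fin n) × EuclideanSpace ℝ (Fin n)) →L[ℝ]
      (EuclideanSpace ℝ (Fin n) × EuclideanSpace ℝ (Fin n)) :=
  (ContinuousLinearMap.inr ℝ _ _).comp (ContinuousLinearMap.fst ℝ _ _)

/-- The Liouville vector field `C = yⁱ ∂/∂yⁱ` in standard coordinates. -/
def liouvilleField (z : EuclideanSpace ℝ (Fin n) × EuclideanSpace ℝ (Fin n)) :
    EuclideanSpace ℝ (Fin n) × EuclideanSpace ℝ (Fin n) :=
  (0, z.2)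

/-- The 1-form `d_J F = dF ∘ J`. -/
def verticalDifferential (F : EuclideanSpace ℝ (Fin n) × EuclideanSpace ℝ (Fin n) → ℝ)
    (z : EuclideanSpace ℝ (Fin n) × EuclideanSpace ℝ (Fin n)) :
    (EuclideanSpace ℝ (Fin n) × EuclideanSpace ℝ (Fin n)) [⋀^Fin 1]→L[ℝ] ℝ :=
  ContinuousAlternatingMap.ofSubsingleton ℝ _ ℝ (0 : Fin 1)
    ((fderiv ℝ F z).comp (verticalEndomorphism n))

/-- The value on `w` of the Euler-Lagrange form `ω_F = i_S Ω_F + d(d_C F - F)`, `Ω_F = d d_J F`,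
for a vector field `S` and a function `F` of the standard coordinates `z = (x, y)`. -/
def eulerLagrangeForm
    (S : EuclideanSpace ℝ (Fin n) × EuclideanSpace ℝ (Fin n) →
      EuclideanSpace ℝ (Fin n) × EuclideanSpace ℝ (Fin n))
    (F : EuclideanSpace ℝ (Fin n) × EuclideanSpace ℝ (Fin n) → ℝ)
    (z w : EuclideanSpace ℝ (Fin n) × EuclideanSpace ℝ (Fin n)) : ℝ :=
  extDeriv (verticalDifferential F) z ![S z, w] +
    fderiv ℝ (fun z' => fderiv ℝ F z' (liouvilleField z') - F z') z w

/-- The expression in standard coordinates of a vector field `S` on `TM`. -/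
def coordField [IsManifold (𝓡 n) 1 M] (φ : OpenPartialHomeomorph M (EuclideanSpace ℝ (Fin n)))
    (S : (p : TangentBundle (𝓡 n) M) → TangentSpace (𝓡 n).tangent p)
    (z : EuclideanSpace ℝ (Fin n) × EuclideanSpace ℝ (Fin n)) :
    EuclideanSpace ℝ (Fin n) × EuclideanSpace ℝ (Fin n) :=
  mfderiv (𝓡 n).tangent 𝓘(ℝ, EuclideanSpace ℝ (Fin n) × EuclideanSpace ℝ (Fin n))
    (tangentChart φ) (tangentChartInv φ z) (S (tangentChartInv φ z))

/-- `L` solves on `U ⊆ TM` the Euler-Lagrange equation `ω_L = 0` associated to `S`: the form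
`ω_L` vanishes at the points of `U`, in the standard coordinates of every smooth chart. -/
def SolvesEulerLagrangeOn [IsManifold (𝓡 n) 1 M]
    (S : (p : TangentBundle (𝓡 n) M) → TangentSpace (𝓡 n).tangent p)
    (L : TangentBundle (𝓡 n) M → ℝ) (U : Set (TangentBundle (𝓡 n) M)) : Prop :=
  ∀ φ ∈ IsManifold.maximalAtlas (𝓡 n) ∞ M,
    ∀ z : EuclideanSpace ℝ (Fin n) × EuclideanSpace ℝ (Fin n),
      z.1 ∈ φ.target → tangentChartInv φ z ∈ U →
        ∀ w, eulerLagrangeForm (coordField φ S) (L ∘ tangentChartInv φ) z w = 0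

/-- The slit tangent bundle `TM ∖ {0}`: the set of nonzero tangent vectors. -/
def slitTangentBundle (n : ℕ) (M : Type*) [TopologicalSpace M]
    [ChartedSpace (EuclideanSpace ℝ (Fin n)) M] : Set (TangentBundle (𝓡 n) M) :=
  {p | p.2 ≠ 0}

end LagrangianGeometry

section LieGroup

variable {n : ℕ} {G : Type*} [TopologicalSpace G] [ChartedSpace (EuclideanSpace ℝ (Fin n)) G]
  [Group G]

instance [LieGroup (𝓡 n) ∞ G] : IsManifold (𝓡 n) 1 G :=
  IsManifold.of_le (n := ∞) (by norm_cast)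

/-- The inverse of the left trivialisation, `G × 𝔤 → TG`, `(x, α) ↦ λ_{x*} α`.  (As a normed
space, the Lie algebra `𝔤 = T_e G` is the model space.) -/
def leftTriv (q : G × EuclideanSpace ℝ (Fin n)) : TangentBundle (𝓡 n) G :=
  ⟨q.1, mulInvariantVectorField (I := 𝓡 n) (G := G) q.2 q.1⟩

/-- The Maurer-Cartan form `θ : TG → 𝔤`, `θ (x, v) = (λ_x⁻¹)_* v`. -/
def maurerCartan (p : TangentBundle (𝓡 n) G) : EuclideanSpace ℝ (Fin n) :=
  mfderiv (𝓡 n) (𝓡 n) (fun h : G => p.1⁻¹ * h) p.1 p.2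

/-- The canonical spray of `G`: at the point with left trivialisation `(x, α)` it is the vector
`λ_x α ∂/∂x`, that is, `(λ_{x*} α, 0)` carried from `T_x G × 𝔤` to `T(TG)`. -/
def canonicalSpray [IsManifold (𝓡 n) 1 G] (p : TangentBundle (𝓡 n) G) :
    TangentSpace (𝓡 n).tangent p :=
  mfderiv ((𝓡 n).prod (𝓡 n)) (𝓡 n).tangent (leftTriv (n := n) (G := G))
    (p.1, maurerCartan p)
    ((mulInvariantVectorField (I := 𝓡 n) (G := G) (maurerCartan p) p.1 : EuclideanSpace ℝ (Fin n)),
      (0 : EuclideanSpace ℝ (Fin n)))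

/-- The left trivialisation is smooth. -/
theorem contMDiff_leftTriv [LieGroup (𝓡 n) ∞ G] :
    ContMDiff ((𝓡 n).prod (𝓡 n)) (𝓡 n).tangent ∞ (leftTriv (n := n) (G := G)) := by
  have h1 : ContMDiff (𝓡 n) (𝓡 n).tangent ∞ (fun v : EuclideanSpace ℝ (Fin n) => (⟨1, v⟩ : TangentBundle (𝓡 n) G)) := by
    intro v
    rw [Bundle.contMDiffAt_totalSpace]
    refine ⟨contMDiffAt_const, ?_⟩
    simp only [TangentBundle.trivializationAt_apply]
    exact (ContinuousLinearMap.contDiff _).contMDiff.contMDiffAt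
  have F1 : ContMDiff ((𝓡 n).prod (𝓡 n)) ((𝓡 n).tangent.prod (𝓡 n).tangent) ∞ 
     (fun q : G × EuclideanSpace ℝ (Fin n) => (((⟨q.1, 0⟩ : TangentBundle (𝓡 n) G), (⟨1, q.2⟩ : TangentBundle (𝓡 n) G)))) :=
    ((Bundle.contMDiff_zeroSection ℝ _).comp contMDiff_fst).prodMk (h1.comp contMDiff_snd)
  have S₂ : ContMDiff ((𝓡 n).tangent.prod (𝓡 n).tangent) ((𝓡 n).prod (𝓡 n)).tangent ∞ (equivTangentBundleProd (𝓡 n) G (𝓡 n) G).symm := contMDiff_equivTangentBundleProd_symm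
  have S₃ := (contMDiff_mul (𝓡 n) ∞ (G := G)).contMDiff_tangentMap (m := ∞) (by simp)
  have S := (S₃.comp S₂).comp F1
  convert! S with q
  funext q
  have hd := mfderiv_prod_eq_add_apply (p := (q.1, (1 : G)))
    (v := ((0 : EuclideanSpace ℝ (Fin n)), (q.2 : EuclideanSpace ℝ (Fin n))))
    ((contMDiff_mul (𝓡 n) ∞ (G := G)).mdifferentiableAt (by simp) (x := (q.1, (1 : G))))
  refine Bundle.TotalSpace.ext (mul_one q.1).symm (heq_of_eq ?_)
  refine Eq.trans ?_ hd.symm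
  have hz : ∀ (T T' : EuclideanSpace ℝ (Fin n) →L[ℝ] EuclideanSpace ℝ (Fin n))
      (v : EuclideanSpace ℝ (Fin n)), T' v = T 0 + T' v := by
    intro T T' v
    rw [map_zero, zero_add]
  exact hz _ _ _

/-- The geodesics of the canonical spray include the left translated one-parameter subgroups: their
velocity curves are integral curves of the spray. -/
theorem isMIntegralCurve_canonicalSpray [LieGroup (𝓡 n) ∞ G] (γ : ℝ → G) (hγ : MDifferentiable 𝓘(ℝ, ℝ) (𝓡 n) γ)
    (hadd : ∀ s t, γ (s + t) = γ s * γ t) (g : G) :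
    IsMIntegralCurve (I := (𝓡 n).tangent)
      (fun t => (⟨g * γ t, mfderiv 𝓘(ℝ, ℝ) (𝓡 n) (fun s => g * γ s) t (1 : ℝ)⟩ :
        TangentBundle (𝓡 n) G)) canonicalSpray := by
  have h0 : γ 0 = 1 := by simpa using hadd 0 0
  have hl : ∀ (a x : G), MDifferentiableAt (𝓡 n) (𝓡 n) (fun h : G => a * h) x := fun a x =>
    (contMDiff_mul_left (I := 𝓡 n) (n := ∞) (a := a)).mdifferentiableAt (by simp)
  have hc : ∀ t, MDifferentiableAt 𝓘(ℝ, ℝ) (𝓡 n) (fun s => g * γ s) t := fun t =>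
    (hl g (γ t)).comp t (hγ t)
  obtain ⟨α, hα⟩ : ∃ α : EuclideanSpace ℝ (Fin n), α = mfderiv 𝓘(ℝ, ℝ) (𝓡 n) γ 0 (1 : ℝ) := ⟨_, rfl⟩
  have hvel : ∀ t, mfderiv 𝓘(ℝ, ℝ) (𝓡 n) (fun s => g * γ s) t (1 : ℝ) =
      mulInvariantVectorField (I := 𝓡 n) (G := G) α (g * γ t) := by
    intro t
    have e : (fun s => g * γ s) = (fun h : G => (g * γ t) * h) ∘ γ ∘ (fun s => s - t) := by
      ext s
      simp only [Function.comp_apply, mul_assoc, ← hadd]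
      simp
    have ht : HasMFDerivAt 𝓘(ℝ, ℝ) 𝓘(ℝ, ℝ) (fun s : ℝ => s - t) t (ContinuousLinearMap.id ℝ ℝ) :=
      ((hasFDerivAt_id t).sub_const t).hasMFDerivAt
    have ht2 : HasMFDerivAt 𝓘(ℝ, ℝ) (𝓡 n) (γ ∘ fun s : ℝ => s - t) t
        ((mfderiv 𝓘(ℝ, ℝ) (𝓡 n) γ 0).comp (ContinuousLinearMap.id ℝ ℝ)) := by
      have key : ∀ x : ℝ, x = 0 → HasMFDerivAt 𝓘(ℝ, ℝ) (𝓡 n) γ x (mfderiv 𝓘(ℝ, ℝ) (𝓡 n) γ 0) := by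
        rintro _ rfl
        exact (hγ 0).hasMFDerivAt
      exact HasMFDerivAt.comp t (key _ (sub_self t)) ht
    have hm : HasMFDerivAt (𝓡 n) (𝓡 n) (fun h : G => (g * γ t) * h) ((γ ∘ fun s : ℝ => s - t) t)
        (mfderiv (𝓡 n) (𝓡 n) (fun h : G => (g * γ t) * h) 1) := by
      have key : ∀ x : G, x = 1 → HasMFDerivAt (𝓡 n) (𝓡 n) (fun h : G => (g * γ t) * h) x
          (mfderiv (𝓡 n) (𝓡 n) (fun h : G => (g * γ t) * h) 1) := by
        rintro _ rfl
        exact (hl (g * γ t) 1).hasMFDerivAt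
      exact key _ (by simp [h0])
    have h := (hm.comp t ht2).mfderiv
    rw [e, hα]
    exact congrArg (fun T : ℝ →L[ℝ] EuclideanSpace ℝ (Fin n) => T 1) h
  have hθ : ∀ x : G, maurerCartan (leftTriv (x, α)) = α := by
    intro x
    have key : ∀ y : G, y = x * 1 → HasMFDerivAt (𝓡 n) (𝓡 n) (fun h : G => x⁻¹ * h) y
          (mfderiv (𝓡 n) (𝓡 n) (fun h : G => x⁻¹ * h) x) := by
        intro y hy
        rw [mul_one] at hy
        subst hy
        exact (hl y⁻¹ y).hasMFDerivAt
    have h := ((key _ rfl).comp 1 (hl x 1).hasMFDerivAt).mfderiv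
    have e : ((fun h : G => x⁻¹ * h) ∘ fun h : G => x * h) = id := by
      ext; simp
    rw [e, mfderiv_id] at h
    exact (congrArg (fun T : EuclideanSpace ℝ (Fin n) →L[ℝ] EuclideanSpace ℝ (Fin n) => T α) h).symm
  have hcurve : (fun t => (⟨g * γ t, mfderiv 𝓘(ℝ, ℝ) (𝓡 n) (fun s => g * γ s) t (1 : ℝ)⟩ :
        TangentBundle (𝓡 n) G)) = fun t => leftTriv (g * γ t, α) := by
    funext t
    rw [hvel t]; rfl
  rw [hcurve]
  intro t
  have h1 : HasMFDerivAt 𝓘(ℝ, ℝ) ((𝓡 n).prod (𝓡 n)) (fun s => (g * γ s, α)) t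
      ((mfderiv 𝓘(ℝ, ℝ) (𝓡 n) (fun s => g * γ s) t).prod 0) :=
    (hc t).hasMFDerivAt.prodMk (hasMFDerivAt_const α t)
  have h2 := ((contMDiff_leftTriv (n := n) (G := G)).mdifferentiableAt (by simp)
    (x := (g * γ t, α))).hasMFDerivAt.comp t h1
  have h3 : (1 : ℝ →L[ℝ] ℝ).smulRight (canonicalSpray (leftTriv (g * γ t, α))) =
    (mfderiv ((𝓡 n).prod (𝓡 n)) (𝓡 n).tangent (leftTriv (n := n) (G := G))
      (g * γ t, α)).comp ((mfderiv 𝓘(ℝ, ℝ) (𝓡 n) (fun s => g * γ s) t).prod 0) := by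
    have hp : maurerCartan (leftTriv (g * γ t, α)) = α := hθ _
    refine ContinuousLinearMap.ext_ring ?_
    rw [ContinuousLinearMap.smulRight_apply]
    refine (one_smul ℝ _).trans ?_
    have hcs : canonicalSpray (leftTriv (g * γ t, α)) =
        mfderiv ((𝓡 n).prod (𝓡 n)) (𝓡 n).tangent (leftTriv (n := n) (G := G))
          (g * γ t, maurerCartan (leftTriv (g * γ t, α)))
          ((mulInvariantVectorField (I := 𝓡 n) (G := G) (maurerCartan (leftTriv (g * γ t, α)))
            (g * γ t) : EuclideanSpace ℝ (Fin n)), (0 : EuclideanSpace ℝ (Fin n))) := rfl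
    rw [hcs, hp, ← hvel t]
    rfl
  rw [h3]
  exact h2

/-- `L : TG → ℝ` is left invariant: `L ∘ λ_{g*} = L` for all `g`. -/
def IsLeftInvariant (L : TangentBundle (𝓡 n) G → ℝ) : Prop :=
  ∀ g : G, L ∘ tangentMap (𝓡 n) (𝓡 n) (fun h : G => g * h) = L

/-- The inverse of the semi-invariant coordinate system `(xⁱ, αⁱ)` on `TG` given by a chart `φ` of
`G` and a basis `b` of the Lie algebra: the vector at `φ⁻¹ x` whose Maurer-Cartan form is
`∑ i, αⁱ bᵢ`. -/
def semiInvInv (φ : OpenPartialHomeomorph G (EuclideanSpace ℝ (Fin n)))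
    (b : Module.Basis (Fin n) ℝ (GroupLieAlgebra (𝓡 n) G))
    (x α : EuclideanSpace ℝ (Fin n)) : TangentBundle (𝓡 n) G :=
  leftTriv (φ.symm x, (∑ i, α i • b i : GroupLieAlgebra (𝓡 n) G))

/-- The partial derivative `∂L/∂xⁱ` in semi-invariant coordinates. -/
def partialX (φ : OpenPartialHomeomorph G (EuclideanSpace ℝ (Fin n)))
    (b : Module.Basis (Fin n) ℝ (GroupLieAlgebra (𝓡 n) G))
    (L : TangentBundle (𝓡 n) G → ℝ) (i : Fin n) (x α : EuclideanSpace ℝ (Fin n)) : ℝ :=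
  lineDeriv ℝ (fun x' => L (semiInvInv φ b x' α)) x (EuclideanSpace.single i 1)

/-- The partial derivative `∂L/∂αⁱ` in semi-invariant coordinates. -/
def partialAlpha (φ : OpenPartialHomeomorph G (EuclideanSpace ℝ (Fin n)))
    (b : Module.Basis (Fin n) ℝ (GroupLieAlgebra (𝓡 n) G))
    (L : TangentBundle (𝓡 n) G → ℝ) (i : Fin n) (x α : EuclideanSpace ℝ (Fin n)) : ℝ :=
  lineDeriv ℝ (fun α' => L (semiInvInv φ b x α')) α (EuclideanSpace.single i 1)

/-- The values of `L` do not depend on the base point: they are determined by the Maurer-Cartan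
component. -/
def IndependentOfBase (L : TangentBundle (𝓡 n) G → ℝ) : Prop :=
  ∀ (g h : G) (α : EuclideanSpace ℝ (Fin n)), L (leftTriv (g, α)) = L (leftTriv (h, α))

/-- The system `∂L/∂xⁱ = 0`, `i = 1, …, n`, on `U ⊆ TG`, in the semi-invariant coordinates given
by `b` and any smooth chart. -/
def BaseSystemOn (b : Module.Basis (Fin n) ℝ (GroupLieAlgebra (𝓡 n) G))
    (L : TangentBundle (𝓡 n) G → ℝ) (U : Set (TangentBundle (𝓡 n) G)) : Prop :=
  ∀ φ ∈ IsManifold.maximalAtlas (𝓡 n) ∞ G, ∀ x ∈ φ.target, ∀ α, semiInvInv φ b x α ∈ U →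
    ∀ i, partialX φ b L i x α = 0

/-- The system `[a, α]ⁱ ∂L/∂αⁱ = 0` for all `a ∈ 𝔤`, on `U ⊆ TG`, in the semi-invariant
coordinates given by `b` and any smooth chart. -/
def BracketSystemOn (b : Module.Basis (Fin n) ℝ (GroupLieAlgebra (𝓡 n) G))
    (L : TangentBundle (𝓡 n) G → ℝ) (U : Set (TangentBundle (𝓡 n) G)) : Prop :=
  ∀ φ ∈ IsManifold.maximalAtlas (𝓡 n) ∞ G, ∀ x ∈ φ.target, ∀ α, semiInvInv φ b x α ∈ U →
    ∀ a : GroupLieAlgebra (𝓡 n) G,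
      ∑ i, b.repr ⁅a, (∑ j, α j • b j : GroupLieAlgebra (𝓡 n) G)⁆ i * partialAlpha φ b L i x α = 0

end LieGroup

end

noncomputable section

open Filter Topology

/-! In a chart let `A x` be the Maurer-Cartan form (`chartCoframe`) and `B x` its inverse, the left
invariant frame (`chartFrame`). Since `λ_{g*}` sends `leftTriv (h, α)` to `leftTriv (g * h, α)`,
left invariance is the same as independence of the base point, and then `L (x, y) = l (α)` with `α =
A x y` and `l` the restriction of `L` to `𝔤`.

The spray keeps `α` constant. Hence in `ω_L` all second derivatives of `l` cancel, and what is left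
is `dl_α` applied to the exterior derivative of the coframe (`eulerLagrangeForm_of_frame`). The
Maurer-Cartan equation (`fderiv_chartCoframe_sub`) turns this into `ω_L w = dl_α [A w₁, α]`. As `A
x` is invertible, `ω_L = 0` says `dl_α [a, α] = 0` for all `a`, which is the bracket system written
without a basis.

For connected `G`, the equations `∂L/∂xⁱ = 0` make `L` locally constant in the base point at fixed
`α`, hence constant; continuity takes care of `α = 0`. -/

/-! ### The Euler-Lagrange form of a function of `A x y`. -/

theorem extDeriv_ofSubsingleton_apply {V : Type*} [NormedAddCommGroup V] [NormedSpace ℝ V]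
    {η : V → V →L[ℝ] ℝ} {z : V} (hη : DifferentiableAt ℝ η z) (v w : V) :
    extDeriv (fun z' => ContinuousAlternatingMap.ofSubsingleton ℝ V ℝ (0 : Fin 1) (η z')) z ![v, w] =
      fderiv ℝ η z v w - fderiv ℝ η z w v := by
  have h : HasFDerivAt
      (fun z' => ContinuousAlternatingMap.ofSubsingleton ℝ V ℝ (0 : Fin 1) (η z'))
      ((ContinuousAlternatingMap.ofSubsingletonLIE (𝕜 := ℝ) (E := V) (F := ℝ)
        (0 : Fin 1)).toContinuousLinearEquiv.toContinuousLinearMap.comp (fderiv ℝ η z)) z :=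
    (ContinuousAlternatingMap.ofSubsingletonLIE (𝕜 := ℝ) (E := V) (F := ℝ)
      (0 : Fin 1)).toContinuousLinearEquiv.toContinuousLinearMap.hasFDerivAt.comp z hη.hasFDerivAt
  rw [extDeriv, h.fderiv]
  simp [ContinuousAlternatingMap.alternatizeUncurryFin_apply, Fin.sum_univ_two, sub_eq_add_neg]
  rfl

section
variable {n : ℕ}
local notation "𝔼" => EuclideanSpace ℝ (Fin n)

theorem hasFDerivAt_frame_apply {A : 𝔼 → 𝔼 →L[ℝ] 𝔼} {z : 𝔼 × 𝔼}
    (hA : DifferentiableAt ℝ A z.1) :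
    HasFDerivAt (fun z' : 𝔼 × 𝔼 => A z'.1 z'.2)
      ((A z.1).comp (ContinuousLinearMap.snd ℝ 𝔼 𝔼) +
        ((fderiv ℝ A z.1).comp (ContinuousLinearMap.fst ℝ 𝔼 𝔼)).flip z.2) z := by
  have h1 : HasFDerivAt (fun z' : 𝔼 × 𝔼 => A z'.1)
      ((fderiv ℝ A z.1).comp (ContinuousLinearMap.fst ℝ 𝔼 𝔼)) z :=
    hA.hasFDerivAt.comp z hasFDerivAt_fst
  exact h1.clm_apply hasFDerivAt_snd

/-- `hS₁` says that `S` is a second-order field, and `hS₂` that `S` annihilates `(x, y) ↦ A x y`.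
The term `D²l (dα w) α` occurs in `i_S d d_J F` and in `d (CF - F)` with opposite signs, so the
symmetry of `D²l` plays no role. -/
theorem eulerLagrangeForm_of_frame {A : 𝔼 → 𝔼 →L[ℝ] 𝔼} {l : 𝔼 → ℝ} {S : 𝔼 × 𝔼 → 𝔼 × 𝔼}
    {F : 𝔼 × 𝔼 → ℝ} {z : 𝔼 × 𝔼} (hA : ContDiffAt ℝ 2 A z.1)
    (hl : ContDiffAt ℝ 2 l (A z.1 z.2)) (hF : F =ᶠ[𝓝 z] fun z' => l (A z'.1 z'.2))
    (hS₁ : (S z).1 = z.2) (hS₂ : fderiv ℝ A z.1 z.2 z.2 + A z.1 (S z).2 = 0) (w : 𝔼 × 𝔼) :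
    eulerLagrangeForm S F z w =
      fderiv ℝ l (A z.1 z.2) (fderiv ℝ A z.1 z.2 w.1 - fderiv ℝ A z.1 w.1 z.2) := by
  have hAd : DifferentiableAt ℝ A z.1 := hA.differentiableAt (by norm_num)
  have hAe : ∀ᶠ z' in 𝓝 z, DifferentiableAt ℝ A z'.1 :=
    continuousAt_fst.eventually
      ((hA.eventually (by simp)).mono fun x hx => hx.differentiableAt (by norm_num))
  have hT := hasFDerivAt_frame_apply hAd
  have hle : ∀ᶠ z' in 𝓝 z, DifferentiableAt ℝ l (A z'.1 z'.2) :=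
    hT.continuousAt.eventually
      ((hl.eventually (by simp)).mono fun x hx => hx.differentiableAt (by norm_num))
  have hl' : DifferentiableAt ℝ (fderiv ℝ l) (A z.1 z.2) :=
    (hl.fderiv_right (m := 1) (by norm_num)).differentiableAt (by norm_num)
  have hp : HasFDerivAt (fun z' : 𝔼 × 𝔼 => fderiv ℝ l (A z'.1 z'.2)) _ z :=
    hl'.hasFDerivAt.comp z hT
  have hdF : ∀ᶠ z' in 𝓝 z, fderiv ℝ F z' = (fderiv ℝ l (A z'.1 z'.2)).comp
      ((A z'.1).comp (ContinuousLinearMap.snd ℝ 𝔼 𝔼) +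
        ((fderiv ℝ A z'.1).comp (ContinuousLinearMap.fst ℝ 𝔼 𝔼)).flip z'.2) := by
    filter_upwards [hAe, hle, hF.eventuallyEq_nhds] with z' h1 h2 h3
    rw [h3.fderiv_eq]
    exact (h2.hasFDerivAt.comp z' (hasFDerivAt_frame_apply h1)).fderiv
  have hA1 : HasFDerivAt (fun z' : 𝔼 × 𝔼 => (A z'.1).comp (ContinuousLinearMap.fst ℝ 𝔼 𝔼)) _ z :=
    (hAd.hasFDerivAt.comp z hasFDerivAt_fst).clm_comp (hasFDerivAt_const _ z)
  have hη := hp.clm_comp hA1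
  have hV : verticalDifferential F =ᶠ[𝓝 z] fun z' =>
      ContinuousAlternatingMap.ofSubsingleton ℝ (𝔼 × 𝔼) ℝ (0 : Fin 1)
        ((fderiv ℝ l (A z'.1 z'.2)).comp ((A z'.1).comp (ContinuousLinearMap.fst ℝ 𝔼 𝔼))) := by
    filter_upwards [hdF] with z' h
    rw [verticalDifferential, h]
    congr 1
    ext v <;> simp [verticalEndomorphism]
  -- `α` is linear in `y`, so the Liouville field acts on `F` as the Euler field of `𝔤` acts on `l`.
  have hC : (fun z' => fderiv ℝ F z' (liouvilleField z') - F z') =ᶠ[𝓝 z]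
      fun z' => fderiv ℝ l (A z'.1 z'.2) (A z'.1 z'.2) - l (A z'.1 z'.2) := by
    filter_upwards [hdF, hF] with z' h h2
    rw [h, h2]
    simp [liouvilleField]
  have hE := (hp.clm_apply hT).sub
    ((hl.differentiableAt (by norm_num)).hasFDerivAt.comp z hT)
  rw [eulerLagrangeForm, hV.extDeriv_eq, hC.fderiv_eq,
    extDeriv_ofSubsingleton_apply hη.differentiableAt, hη.fderiv]
  erw [hE.fderiv]
  -- The only Hessian term that does not cancel by itself is the derivative of `dl_α` along `S`; it
  -- vanishes because `α` is constant along `S`.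
  have hS₃ : fderiv ℝ (fderiv ℝ l) (A z.1 z.2) (fderiv ℝ A z.1 z.2 z.2) (A z.1 w.1) +
      fderiv ℝ (fderiv ℝ l) (A z.1 z.2) (A z.1 (S z).2) (A z.1 w.1) = 0 := by
    rw [← add_apply, ← map_add, hS₂]
    simp
  simp [hS₁]
  linear_combination hS₃

/-! ### Differentials of a chart and of its inverse. -/

section
variable {M : Type*} [TopologicalSpace M] [ChartedSpace (EuclideanSpace ℝ (Fin n)) M]
  {φ : OpenPartialHomeomorph M (EuclideanSpace ℝ (Fin n))}

theorem hasMFDerivAt_chart (hφ : φ ∈ IsManifold.maximalAtlas (𝓡 n) ∞ M) {m : M}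
    (hm : m ∈ φ.source) :
    HasMFDerivAt (𝓡 n) (𝓡 n) φ m (mfderiv (𝓡 n) (𝓡 n) φ m) :=
  ((contMDiffAt_of_mem_maximalAtlas hφ hm).mdifferentiableAt (by simp)).hasMFDerivAt

theorem hasMFDerivAt_chart_symm (hφ : φ ∈ IsManifold.maximalAtlas (𝓡 n) ∞ M) {x : 𝔼}
    (hx : x ∈ φ.target) :
    HasMFDerivAt (𝓡 n) (𝓡 n) φ.symm x (mfderiv (𝓡 n) (𝓡 n) φ.symm x) :=
  ((contMDiffAt_symm_of_mem_maximalAtlas hφ hx).mdifferentiableAt (by simp)).hasMFDerivAt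

theorem mfderiv_chart_comp_symm (hφ : φ ∈ IsManifold.maximalAtlas (𝓡 n) ∞ M) {x : 𝔼}
    (hx : x ∈ φ.target) :
    ContinuousLinearMap.comp (mfderiv (𝓡 n) (𝓡 n) φ (φ.symm x) : 𝔼 →L[ℝ] 𝔼)
      (mfderiv (𝓡 n) (𝓡 n) φ.symm x : 𝔼 →L[ℝ] 𝔼) = ContinuousLinearMap.id ℝ 𝔼 := by
  have h1 := (hasMFDerivAt_chart hφ (φ.map_target hx)).comp x (hasMFDerivAt_chart_symm hφ hx)
  have h2 : φ ∘ φ.symm =ᶠ[𝓝 x] id := φ.eventually_right_inverse hx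
  exact hasMFDerivAt_unique h1 ((hasMFDerivAt_id x).congr_of_eventuallyEq h2)

/-- In finite dimension a one-sided inverse of an endomorphism is two-sided. -/
theorem mfderiv_chart_symm_comp (hφ : φ ∈ IsManifold.maximalAtlas (𝓡 n) ∞ M) {x : 𝔼}
    (hx : x ∈ φ.target) :
    ContinuousLinearMap.comp (mfderiv (𝓡 n) (𝓡 n) φ.symm x : 𝔼 →L[ℝ] 𝔼)
      (mfderiv (𝓡 n) (𝓡 n) φ (φ.symm x) : 𝔼 →L[ℝ] 𝔼) = ContinuousLinearMap.id ℝ 𝔼 := by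
  have key : ∀ f g : 𝔼 →L[ℝ] 𝔼, f.comp g = ContinuousLinearMap.id ℝ 𝔼 →
      g.comp f = ContinuousLinearMap.id ℝ 𝔼 := fun f g h =>
    ContinuousLinearMap.coe_injective
      ((LinearMap.comp_eq_id_comm _ _).mp (congrArg ContinuousLinearMap.toLinearMap h))
  exact key _ _ (mfderiv_chart_comp_symm hφ hx)

end

/-! ### Left translations and the left trivialisation. -/

variable {G : Type*} [TopologicalSpace G] [ChartedSpace (EuclideanSpace ℝ (Fin n)) G]
  [Group G]

/-- The differential of left translation by `g` at `h`, as a map between copies of the model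
space. -/
def leftDeriv (g h : G) : 𝔼 →L[ℝ] 𝔼 :=
  mfderiv (𝓡 n) (𝓡 n) (fun k : G => g * k) h

theorem leftDeriv_one (h : G) : leftDeriv (n := n) (1 : G) h = ContinuousLinearMap.id ℝ 𝔼 := by
  have e : (fun k : G => 1 * k) = id := by ext; simp
  rw [leftDeriv, e]
  exact mfderiv_id

section
variable [LieGroup (𝓡 n) ∞ G]

theorem hasMFDerivAt_leftDeriv (g h : G) :
    HasMFDerivAt (𝓡 n) (𝓡 n) (fun k : G => g * k) h (leftDeriv (n := n) g h) :=
  ((contMDiff_mul_left (I := 𝓡 n) (n := ∞) (a := g)).mdifferentiableAt (by simp)).hasMFDerivAt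

theorem leftDeriv_mul (g g' h : G) :
    leftDeriv (n := n) (g * g') h = (leftDeriv g (g' * h)).comp (leftDeriv g' h) := by
  have h1 := ((hasMFDerivAt_leftDeriv (n := n) g (g' * h)).comp h
    (hasMFDerivAt_leftDeriv g' h)).mfderiv
  have e : (fun k : G => g * k) ∘ (fun k => g' * k) = fun k => (g * g') * k := by
    ext k; simp [mul_assoc]
  rw [e] at h1
  exact h1

theorem leftDeriv_inv_comp (g : G) :
    (leftDeriv (n := n) g⁻¹ g).comp (leftDeriv g 1) = ContinuousLinearMap.id ℝ 𝔼 := by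
  have := leftDeriv_mul (n := n) g⁻¹ g 1
  rw [inv_mul_cancel, leftDeriv_one, mul_one] at this
  exact this.symm

theorem leftDeriv_comp_inv (g : G) :
    (leftDeriv (n := n) g 1).comp (leftDeriv g⁻¹ g) = ContinuousLinearMap.id ℝ 𝔼 := by
  have := leftDeriv_mul (n := n) g g⁻¹ g
  rw [inv_mul_cancel, mul_inv_cancel, leftDeriv_one] at this
  exact this.symm

theorem maurerCartan_leftTriv (x : G) (α : 𝔼) : maurerCartan (leftTriv (x, α)) = α :=
  congrArg (fun T : 𝔼 →L[ℝ] 𝔼 => T α) (leftDeriv_inv_comp x)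

theorem leftTriv_maurerCartan (p : TangentBundle (𝓡 n) G) : leftTriv (p.1, maurerCartan p) = p :=
  Bundle.TotalSpace.ext rfl (heq_of_eq
    (congrArg (fun T : 𝔼 →L[ℝ] 𝔼 => T p.2) (leftDeriv_comp_inv p.1)))

theorem tangentMap_mul_left_leftTriv (g h : G) (α : 𝔼) :
    tangentMap (𝓡 n) (𝓡 n) (fun k : G => g * k) (leftTriv (h, α)) = leftTriv (g * h, α) := by
  have key := leftDeriv_mul (n := n) g h 1
  rw [mul_one] at key
  exact Bundle.TotalSpace.ext rfl (heq_of_eq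
    (congrArg (fun T : 𝔼 →L[ℝ] 𝔼 => T α) key.symm))

theorem isLeftInvariant_iff_independentOfBase {L : TangentBundle (𝓡 n) G → ℝ} :
    IsLeftInvariant L ↔ IndependentOfBase L := by
  constructor
  · intro hL g h α
    have := congrFun (hL (h * g⁻¹)) (leftTriv (g, α))
    rw [Function.comp_apply, tangentMap_mul_left_leftTriv] at this
    simpa using this.symm
  · intro hL g
    funext p
    rw [← leftTriv_maurerCartan p, Function.comp_apply, tangentMap_mul_left_leftTriv]
    exact hL _ _ _

theorem leftTriv_mem_slitTangentBundle_iff (x : G) (α : 𝔼) :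
    leftTriv (x, α) ∈ slitTangentBundle n G ↔ α ≠ 0 := by
  change leftDeriv x 1 α ≠ 0 ↔ α ≠ 0
  refine not_congr ⟨fun h => ?_, fun h => by rw [h, map_zero]⟩
  have := congrArg (fun T : 𝔼 →L[ℝ] 𝔼 => T α) (leftDeriv_inv_comp x)
  simpa [h] using this.symm

end

/-! ### The left invariant frame and coframe in a chart. -/

/-- The frame of left invariant vector fields in a chart: `α ↦ dφ (λ_{x*} α)`. -/
def chartFrame (φ : OpenPartialHomeomorph G 𝔼) (x : 𝔼) : 𝔼 →L[ℝ] 𝔼 :=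
  ContinuousLinearMap.comp (mfderiv (𝓡 n) (𝓡 n) φ (φ.symm x) : 𝔼 →L[ℝ] 𝔼)
    (leftDeriv (φ.symm x) 1)

/-- The Maurer-Cartan form in a chart. -/
def chartCoframe (φ : OpenPartialHomeomorph G 𝔼) (x : 𝔼) : 𝔼 →L[ℝ] 𝔼 :=
  (leftDeriv (φ.symm x)⁻¹ (φ.symm x)).comp
    (mfderiv (𝓡 n) (𝓡 n) φ.symm x : 𝔼 →L[ℝ] 𝔼)

theorem tangentChart_leftTriv {φ : OpenPartialHomeomorph G 𝔼} {x : 𝔼} (hx : x ∈ φ.target) (α : 𝔼) :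
    tangentChart φ (leftTriv (φ.symm x, α)) = (x, chartFrame φ x α) :=
  Prod.ext (φ.right_inv hx) rfl

variable [LieGroup (𝓡 n) ∞ G] {φ : OpenPartialHomeomorph G (EuclideanSpace ℝ (Fin n))}

theorem chartCoframe_comp_chartFrame (hφ : φ ∈ IsManifold.maximalAtlas (𝓡 n) ∞ G) {x : 𝔼}
    (hx : x ∈ φ.target) :
    (chartCoframe φ x).comp (chartFrame φ x) = ContinuousLinearMap.id ℝ 𝔼 := by
  ext1 v
  have h1 := congrArg (fun T : 𝔼 →L[ℝ] 𝔼 => T (leftDeriv (φ.symm x) 1 v))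
    (mfderiv_chart_symm_comp hφ hx)
  have h2 := congrArg (fun T : 𝔼 →L[ℝ] 𝔼 => T v) (leftDeriv_inv_comp (φ.symm x))
  exact (congrArg (leftDeriv (φ.symm x)⁻¹ (φ.symm x)) h1).trans h2

theorem chartFrame_comp_chartCoframe (hφ : φ ∈ IsManifold.maximalAtlas (𝓡 n) ∞ G) {x : 𝔼}
    (hx : x ∈ φ.target) :
    (chartFrame φ x).comp (chartCoframe φ x) = ContinuousLinearMap.id ℝ 𝔼 := by
  ext1 v
  have h1 := congrArg (fun T : 𝔼 →L[ℝ] 𝔼 => T ((mfderiv (𝓡 n) (𝓡 n) φ.symm x : 𝔼 →L[ℝ] 𝔼) v))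
    (leftDeriv_comp_inv (φ.symm x))
  have h2 := congrArg (fun T : 𝔼 →L[ℝ] 𝔼 => T v) (mfderiv_chart_comp_symm hφ hx)
  exact (congrArg (mfderiv (𝓡 n) (𝓡 n) φ (φ.symm x) : 𝔼 →L[ℝ] 𝔼) h1).trans h2

theorem tangentChartInv_eq_leftTriv (z : 𝔼 × 𝔼) :
    tangentChartInv φ z = leftTriv (φ.symm z.1, chartCoframe φ z.1 z.2) :=
  (leftTriv_maurerCartan (tangentChartInv φ z)).symm

theorem contMDiffAt_tangentChart (hφ : φ ∈ IsManifold.maximalAtlas (𝓡 n) ∞ G)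
    {p : TangentBundle (𝓡 n) G} (hp : p.1 ∈ φ.source) :
    ContMDiffAt (𝓡 n).tangent 𝓘(ℝ, 𝔼 × 𝔼) ∞ (tangentChart φ) p := by
  have ho : IsOpen (Bundle.TotalSpace.proj ⁻¹' φ.source : Set (TangentBundle (𝓡 n) G)) :=
    φ.open_source.preimage (FiberBundle.continuous_proj 𝔼 (TangentSpace (𝓡 n) (M := G)))
  have h1 := ((contMDiffOn_of_mem_maximalAtlas hφ).contMDiffOn_tangentMapWithin (m := ∞) (by simp)
    φ.open_source.uniqueMDiffOn).contMDiffAt (ho.mem_nhds hp)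
  have h2 : ContMDiffAt (𝓡 n).tangent (𝓡 n) ∞ (fun p : TangentBundle (𝓡 n) G => φ p.1) p :=
    (contMDiffAt_of_mem_maximalAtlas hφ hp).comp p
      (Bundle.contMDiff_proj (TangentSpace (𝓡 n) (M := G))).contMDiffAt
  have h3 := (contMDiff_snd_tangentBundle_modelSpace (n := ∞) 𝔼 (𝓡 n)).contMDiffAt.comp p h1
  refine (h2.prodMk_space h3).congr_of_eventuallyEq ?_
  filter_upwards [ho.mem_nhds hp] with q hq
  refine Prod.ext rfl ?_
  change mfderiv (𝓡 n) (𝓡 n) φ q.1 q.2 = mfderivWithin (𝓡 n) (𝓡 n) φ φ.source q.1 q.2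
  rw [mfderivWithin_of_isOpen φ.open_source hq]

/-- At fixed `α` the frame is the fibre component of `leftTriv (·, α)` read in charts; in finite
dimension, smoothness of an operator-valued map can be tested on vectors. -/
theorem contDiffOn_chartFrame (hφ : φ ∈ IsManifold.maximalAtlas (𝓡 n) ∞ G) :
    ContDiffOn ℝ ∞ (chartFrame φ) φ.target := by
  rw [contDiffOn_clm_apply]
  intro α x hx
  have h1 : ContMDiffAt (𝓡 n) ((𝓡 n).prod (𝓡 n)) ∞ (fun x' => (φ.symm x', α)) x :=
    (contMDiffAt_symm_of_mem_maximalAtlas hφ hx).prodMk contMDiffAt_const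
  have h2 := (contMDiff_leftTriv (n := n) (G := G)).contMDiffAt.comp x h1
  have h3 := ContMDiffAt.comp x
    (contMDiffAt_tangentChart hφ (p := leftTriv (φ.symm x, α)) (φ.map_target hx)) h2
  exact h3.contDiffAt.snd.contDiffWithinAt

theorem contDiffAt_chartFrame (hφ : φ ∈ IsManifold.maximalAtlas (𝓡 n) ∞ G) {x : 𝔼}
    (hx : x ∈ φ.target) : ContDiffAt ℝ ∞ (chartFrame φ) x :=
  (contDiffOn_chartFrame hφ).contDiffAt (φ.open_target.mem_nhds hx)

theorem inverse_chartFrame (hφ : φ ∈ IsManifold.maximalAtlas (𝓡 n) ∞ G) {x : 𝔼}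
    (hx : x ∈ φ.target) : (chartFrame φ x).inverse = chartCoframe φ x :=
  ContinuousLinearMap.inverse_eq (chartFrame_comp_chartCoframe hφ hx)
    (chartCoframe_comp_chartFrame hφ hx)

theorem contDiffAt_chartCoframe (hφ : φ ∈ IsManifold.maximalAtlas (𝓡 n) ∞ G) {x : 𝔼}
    (hx : x ∈ φ.target) : ContDiffAt ℝ ∞ (chartCoframe φ) x := by
  have h0 : ContDiffAt ℝ ∞ (ContinuousLinearMap.inverse : (𝔼 →L[ℝ] 𝔼) → 𝔼 →L[ℝ] 𝔼)
      (chartFrame φ x) :=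
    contDiffAt_map_inverse (ContinuousLinearEquiv.equivOfInverse' (chartFrame φ x) _
      (chartFrame_comp_chartCoframe hφ hx) (chartCoframe_comp_chartFrame hφ hx))
  have h1 : ContDiffAt ℝ ∞ (fun x' => (chartFrame φ x').inverse) x :=
    h0.comp x (contDiffAt_chartFrame hφ hx)
  refine h1.congr_of_eventuallyEq ?_
  filter_upwards [φ.open_target.mem_nhds hx] with x' hx'
  exact (inverse_chartFrame hφ hx').symm

/-- The derivative of the constant `A x ∘ B x = id`. -/
theorem fderiv_chartCoframe_chartFrame (hφ : φ ∈ IsManifold.maximalAtlas (𝓡 n) ∞ G) {x : 𝔼}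
    (hx : x ∈ φ.target) (u α : 𝔼) :
    fderiv ℝ (chartCoframe φ) x u (chartFrame φ x α) +
      chartCoframe φ x (fderiv ℝ (chartFrame φ) x u α) = 0 := by
  have hA := ((contDiffAt_chartCoframe hφ hx).differentiableAt (by simp)).hasFDerivAt
  have hB := ((contDiffAt_chartFrame hφ hx).differentiableAt (by simp)).hasFDerivAt
  have h1 := hA.clm_comp hB
  have h2 : HasFDerivAt (fun x' => (chartCoframe φ x').comp (chartFrame φ x'))
      (0 : 𝔼 →L[ℝ] 𝔼 →L[ℝ] 𝔼) x :=
    (hasFDerivAt_const (ContinuousLinearMap.id ℝ 𝔼) x).congr_of_eventuallyEq (by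
      filter_upwards [φ.open_target.mem_nhds hx] with x' hx'
      exact chartCoframe_comp_chartFrame hφ hx')
  have h3 := congrArg (fun T : 𝔼 →L[ℝ] 𝔼 →L[ℝ] 𝔼 => T u α) (h1.unique h2)
  simpa [add_comm] using h3

/-! ### The Lie bracket, the Maurer-Cartan equation and the spray in a chart. -/

variable (G) in
/-- The bracket of the Lie algebra of `G`, as an operation on the model space. -/
def modelBracket (α β : 𝔼) : 𝔼 :=
  Bracket.bracket (L := GroupLieAlgebra (𝓡 n) G) (M := GroupLieAlgebra (𝓡 n) G) α β

theorem mpullback_chart_symm_mulInvariantVectorField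
    (hφ : φ ∈ IsManifold.maximalAtlas (𝓡 n) ∞ G) {x : 𝔼} (hx : x ∈ φ.target) (γ : 𝔼) :
    VectorField.mpullback (𝓡 n) (𝓡 n) φ.symm
      (mulInvariantVectorField (γ : GroupLieAlgebra (𝓡 n) G)) x = chartFrame φ x γ := by
  have h : (mfderiv (𝓡 n) (𝓡 n) φ.symm x : 𝔼 →L[ℝ] 𝔼).inverse =
      (mfderiv (𝓡 n) (𝓡 n) φ (φ.symm x) : 𝔼 →L[ℝ] 𝔼) :=
    ContinuousLinearMap.inverse_eq (mfderiv_chart_symm_comp hφ hx) (mfderiv_chart_comp_symm hφ hx)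
  exact congrArg (fun T : 𝔼 →L[ℝ] 𝔼 => T (leftDeriv (φ.symm x) 1 γ)) h

/-- The left invariant frame of a chart satisfies the bracket relations of the Lie algebra. -/
theorem lieBracket_chartFrame (hφ : φ ∈ IsManifold.maximalAtlas (𝓡 n) ∞ G) {x : 𝔼}
    (hx : x ∈ φ.target) (α β : 𝔼) :
    VectorField.lieBracket ℝ (fun x' => chartFrame φ x' α) (fun x' => chartFrame φ x' β) x =
      chartFrame φ x (modelBracket G α β) := by
  have hle : minSmoothness ℝ 3 ≤ ∞ := by simp; norm_cast
  have : LieGroup (𝓡 n) (minSmoothness ℝ 3) G := LieGroup.of_le hle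
  -- The identification is needed on a neighbourhood, since the bracket differentiates the fields.
  have he : ∀ γ : 𝔼, VectorField.mpullback (𝓡 n) (𝓡 n) φ.symm
      (mulInvariantVectorField (γ : GroupLieAlgebra (𝓡 n) G)) =ᶠ[𝓝 x]
        fun x' => chartFrame φ x' γ := fun γ => by
    filter_upwards [φ.open_target.mem_nhds hx] with x' hx'
    exact mpullback_chart_symm_mulInvariantVectorField hφ hx' γ
  have h1 := VectorField.mpullback_mlieBracket (I := 𝓡 n) (I' := 𝓡 n) (n := minSmoothness ℝ 3)
    (f := φ.symm) (x₀ := x)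
    (mdifferentiableAt_mulInvariantVectorField (α : GroupLieAlgebra (𝓡 n) G))
    (mdifferentiableAt_mulInvariantVectorField (β : GroupLieAlgebra (𝓡 n) G))
    ((contMDiffAt_symm_of_mem_maximalAtlas hφ hx).of_le hle)
    (minSmoothness_monotone (by norm_cast))
  have h2 := congrArg (fun V => VectorField.mpullback (𝓡 n) (𝓡 n) φ.symm V x)
    (mulInvariantVector_mlieBracket (I := 𝓡 n) (G := G) α β)
  refine ((mpullback_chart_symm_mulInvariantVectorField hφ hx _).symm.trans
    (h2.trans (h1.trans ?_))).symm
  rw [← VectorField.mlieBracketWithin_univ,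
    VectorField.mlieBracketWithin_eq_lieBracketWithin]
  refine (congrFun VectorField.lieBracketWithin_univ x).trans ?_
  exact Filter.EventuallyEq.lieBracket_vectorField_eq (he α) (he β)

/-- The Maurer-Cartan equation in a chart. -/
theorem fderiv_chartCoframe_sub (hφ : φ ∈ IsManifold.maximalAtlas (𝓡 n) ∞ G) {x : 𝔼}
    (hx : x ∈ φ.target) (α β : 𝔼) :
    fderiv ℝ (chartCoframe φ) x (chartFrame φ x α) (chartFrame φ x β) -
      fderiv ℝ (chartCoframe φ) x (chartFrame φ x β) (chartFrame φ x α) =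
        modelBracket G β α := by
  have hB : ∀ γ : 𝔼, HasFDerivAt (fun x' => chartFrame φ x' γ)
      ((fderiv ℝ (chartFrame φ) x).flip γ) x := fun γ => by
    simpa using ((contDiffAt_chartFrame hφ hx).differentiableAt
      (by simp)).hasFDerivAt.clm_apply (hasFDerivAt_const γ x)
  -- The order `β`, `α` absorbs the sign that appears when derivatives of the frame are traded for
  -- derivatives of the coframe.
  have h := lieBracket_chartFrame hφ hx β α
  rw [VectorField.lieBracket, (hB α).fderiv, (hB β).fderiv] at h
  have h' := congrArg (chartCoframe φ x) h
  rw [map_sub] at h'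
  refine Eq.trans ?_ (h'.trans (congrArg (fun T : 𝔼 →L[ℝ] 𝔼 => T (modelBracket G β α))
    (chartCoframe_comp_chartFrame hφ hx)))
  have e1 := fderiv_chartCoframe_chartFrame hφ hx (chartFrame φ x α) β
  have e2 := fderiv_chartCoframe_chartFrame hφ hx (chartFrame φ x β) α
  rw [eq_neg_of_add_eq_zero_left e1, eq_neg_of_add_eq_zero_left e2]
  simp only [ContinuousLinearMap.flip_apply]
  abel

/-- With `α` frozen, `x' ↦ leftTriv (φ.symm x', α)` reads `x' ↦ (x', B x' α)` in coordinates. The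
spray is its derivative in the direction `y`, computed once by the chain rule and once directly. -/
theorem coordField_canonicalSpray (hφ : φ ∈ IsManifold.maximalAtlas (𝓡 n) ∞ G) {z : 𝔼 × 𝔼}
    (hz : z.1 ∈ φ.target) :
    coordField φ canonicalSpray z =
      (z.2, fderiv ℝ (chartFrame φ) z.1 z.2 (chartCoframe φ z.1 z.2)) := by
  obtain ⟨α, hα⟩ : ∃ α, α = chartCoframe φ z.1 z.2 := ⟨_, rfl⟩
  have hpα : leftTriv (φ.symm z.1, α) = tangentChartInv φ z := by
    rw [hα]; exact (tangentChartInv_eq_leftTriv z).symm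
  have hT := ((contMDiffAt_tangentChart hφ (p := leftTriv (φ.symm z.1, α))
    (φ.map_target hz)).mdifferentiableAt (by simp)).hasMFDerivAt
  have hL := ((contMDiff_leftTriv (n := n) (G := G)).mdifferentiableAt (by simp)
    (x := (φ.symm z.1, α))).hasMFDerivAt
  have hγ : HasMFDerivAt (𝓡 n) ((𝓡 n).prod (𝓡 n)) (fun x' => (φ.symm x', α)) z.1
      ((mfderiv (𝓡 n) (𝓡 n) φ.symm z.1).prod 0) :=
    (hasMFDerivAt_chart_symm hφ hz).prodMk (hasMFDerivAt_const α z.1)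
  have h1 := hT.comp z.1 (hL.comp z.1 hγ)
  have h2 : HasFDerivAt (fun x' => (x', chartFrame φ x' α))
      ((ContinuousLinearMap.id ℝ 𝔼).prod ((fderiv ℝ (chartFrame φ) z.1).flip α)) z.1 := by
    refine (hasFDerivAt_id z.1).prodMk ?_
    simpa using ((contDiffAt_chartFrame hφ hz).differentiableAt
      (by simp)).hasFDerivAt.clm_apply (hasFDerivAt_const α z.1)
  have h3 := h2.hasMFDerivAt.congr_of_eventuallyEq
    (f₁ := tangentChart φ ∘ leftTriv ∘ fun x' => (φ.symm x', α)) (by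
    filter_upwards [φ.open_target.mem_nhds hz] with x' hx'
    exact tangentChart_leftTriv hx' α)
  have h4 := hasMFDerivAt_unique h1 h3
  have h5 := congrArg (fun T : 𝔼 →L[ℝ] 𝔼 × 𝔼 => T z.2) h4
  rw [← hα]
  refine Eq.trans ?_ h5
  have hv : mulInvariantVectorField (I := 𝓡 n) (G := G) α (φ.symm z.1) =
    (mfderiv (𝓡 n) (𝓡 n) φ.symm z.1 z.2) := by
    rw [hα]
    exact congrArg (fun T : 𝔼 →L[ℝ] 𝔼 => T (mfderiv (𝓡 n) (𝓡 n) φ.symm z.1 z.2))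
      (leftDeriv_comp_inv (φ.symm z.1))
  unfold coordField canonicalSpray
  rw [← hpα, maurerCartan_leftTriv]
  change mfderiv (𝓡 n).tangent 𝓘(ℝ, 𝔼 × 𝔼) (tangentChart φ) (leftTriv (φ.symm z.1, α))
    (mfderiv ((𝓡 n).prod (𝓡 n)) (𝓡 n).tangent (leftTriv (n := n) (G := G)) (φ.symm z.1, α)
      ((mulInvariantVectorField (I := 𝓡 n) (G := G) α (φ.symm z.1) : 𝔼), (0 : 𝔼))) = _
  rw [hv]
  rfl
-- Reduction of both systems to one equation on the Lie algebra.
variable {U : Set (TangentBundle (𝓡 n) G)} {V : Set (EuclideanSpace ℝ (Fin n))}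
  {L : TangentBundle (𝓡 n) G → ℝ}

/-- Both choices of `U` are products `G × V` in the left trivialisation; the later arguments use
only this form of `U`. -/
theorem exists_isOpen_leftTriv_mem_iff (hU : U = univ ∨ U = slitTangentBundle n G) :
    ∃ V : Set 𝔼, IsOpen V ∧ (∀ α, α ≠ 0 → α ∈ V) ∧
      ∀ (g : G) (α : 𝔼), leftTriv (g, α) ∈ U ↔ α ∈ V := by
  rcases hU with rfl | rfl
  · exact ⟨univ, isOpen_univ, fun _ _ => mem_univ _, fun _ _ => by simp⟩
  · exact ⟨{0}ᶜ, isOpen_compl_singleton, fun _ h => h, leftTriv_mem_slitTangentBundle_iff⟩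

theorem contDiffOn_leftTriv_comp (hV : ∀ (g : G) (α : 𝔼), leftTriv (g, α) ∈ U ↔ α ∈ V)
    (hL : ContMDiffOn (𝓡 n).tangent 𝓘(ℝ, ℝ) ∞ L U) (g : G) :
    ContDiffOn ℝ ∞ (fun α : 𝔼 => L (leftTriv (g, α))) V := by
  have h : ContMDiff (𝓡 n) (𝓡 n).tangent ∞ (fun α : 𝔼 => leftTriv (g, α)) :=
    contMDiff_leftTriv.comp (contMDiff_const.prodMk contMDiff_id)
  exact (hL.comp h.contMDiffOn fun α hα => (hV g α).mpr hα).contDiffOn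

theorem contDiffOn_chart_symm_comp (hV : ∀ (g : G) (α : 𝔼), leftTriv (g, α) ∈ U ↔ α ∈ V)
    (hL : ContMDiffOn (𝓡 n).tangent 𝓘(ℝ, ℝ) ∞ L U)
    {φ : OpenPartialHomeomorph G 𝔼} (hφ : φ ∈ IsManifold.maximalAtlas (𝓡 n) ∞ G)
    {α : 𝔼} (hα : α ∈ V) :
    ContDiffOn ℝ ∞ (fun x => L (leftTriv (φ.symm x, α))) φ.target := by
  have h : ContMDiffOn (𝓡 n) (𝓡 n).tangent ∞ (fun x => leftTriv (φ.symm x, α)) φ.target :=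
    contMDiff_leftTriv.comp_contMDiffOn
      ((contMDiffOn_symm_of_mem_maximalAtlas hφ).prodMk contMDiffOn_const)
  exact (hL.comp h fun x _ => (hV _ α).mpr hα).contDiffOn

theorem eulerLagrangeForm_canonicalSpray (hVo : IsOpen V) (hind : IndependentOfBase L)
    (hl : ContDiffOn ℝ ∞ (fun α : 𝔼 => L (leftTriv (1, α))) V)
    {φ : OpenPartialHomeomorph G 𝔼} (hφ : φ ∈ IsManifold.maximalAtlas (𝓡 n) ∞ G)
    {z : 𝔼 × 𝔼} (hz : z.1 ∈ φ.target) (hα : chartCoframe φ z.1 z.2 ∈ V) (w : 𝔼 × 𝔼) :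
    eulerLagrangeForm (coordField φ canonicalSpray) (L ∘ tangentChartInv φ) z w =
      fderiv ℝ (fun α : 𝔼 => L (leftTriv ((1 : G), α))) (chartCoframe φ z.1 z.2)
        (modelBracket G (chartCoframe φ z.1 w.1) (chartCoframe φ z.1 z.2)) := by
  have hBA : ∀ y : 𝔼, chartFrame φ z.1 (chartCoframe φ z.1 y) = y := fun y =>
    congrArg (fun T : 𝔼 →L[ℝ] 𝔼 => T y) (chartFrame_comp_chartCoframe hφ hz)
  have hS := coordField_canonicalSpray hφ hz
  have hF : (L ∘ tangentChartInv φ) =ᶠ[𝓝 z]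
      fun z' => L (leftTriv ((1 : G), chartCoframe φ z'.1 z'.2)) :=
    Eventually.of_forall fun z' => by
      rw [Function.comp_apply, tangentChartInv_eq_leftTriv]
      exact hind _ _ _
  -- Taken at `α = A x y`, where `B x α = y`, this says that the Maurer-Cartan component is constant
  -- along the spray.
  have hS₂ := fderiv_chartCoframe_chartFrame hφ hz z.2 (chartCoframe φ z.1 z.2)
  have hMC := fderiv_chartCoframe_sub hφ hz (chartCoframe φ z.1 z.2) (chartCoframe φ z.1 w.1)
  rw [hBA] at hS₂
  rw [hBA, hBA] at hMC
  rw [eulerLagrangeForm_of_frame (A := chartCoframe φ) (l := fun α => L (leftTriv ((1 : G), α)))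
    ((contDiffAt_chartCoframe hφ hz).of_le (by norm_cast))
    ((hl.contDiffAt (hVo.mem_nhds hα)).of_le (by norm_cast)) hF (by rw [hS])
    (by rw [hS]; exact hS₂) w, hMC]

theorem solvesEulerLagrangeOn_canonicalSpray_iff (hVo : IsOpen V)
    (hV : ∀ (g : G) (α : 𝔼), leftTriv (g, α) ∈ U ↔ α ∈ V) (hind : IndependentOfBase L)
    (hL : ContMDiffOn (𝓡 n).tangent 𝓘(ℝ, ℝ) ∞ L U) :
    SolvesEulerLagrangeOn canonicalSpray L U ↔ ∀ α ∈ V, ∀ a : 𝔼,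
      fderiv ℝ (fun α : 𝔼 => L (leftTriv ((1 : G), α))) α (modelBracket G a α) = 0 := by
  have hl := contDiffOn_leftTriv_comp hV hL 1
  constructor
  · intro h α hα a
    -- The target equation does not involve the base point, so one chart around the identity
    -- suffices. The frame supplies a point and a test vector whose Maurer-Cartan components are `α`
    -- and `a`.
    have hφ : chartAt 𝔼 (1 : G) ∈ IsManifold.maximalAtlas (𝓡 n) ∞ G :=
      IsManifold.chart_mem_maximalAtlas 1
    set φ := chartAt 𝔼 (1 : G)
    have hx : φ 1 ∈ φ.target := mem_chart_target 𝔼 (1 : G)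
    have hAB : ∀ γ : 𝔼, chartCoframe φ (φ 1) (chartFrame φ (φ 1) γ) = γ := fun γ =>
      congrArg (fun T : 𝔼 →L[ℝ] 𝔼 => T γ) (chartCoframe_comp_chartFrame hφ hx)
    have h1 := h φ hφ (φ 1, chartFrame φ (φ 1) α) hx
      (by rw [tangentChartInv_eq_leftTriv, hAB, hV]; exact hα) (chartFrame φ (φ 1) a, 0)
    rw [eulerLagrangeForm_canonicalSpray hVo hind hl hφ hx (by rw [hAB]; exact hα)] at h1
    simpa only [hAB] using h1
  · intro h φ hφ z hz hzU w
    rw [tangentChartInv_eq_leftTriv, hV] at hzU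
    rw [eulerLagrangeForm_canonicalSpray hVo hind hl hφ hz hzU]
    exact h _ hzU _

theorem lineDeriv_sum_smul {l : 𝔼 → ℝ} {c : Fin n → 𝔼} {α : 𝔼}
    (hl : DifferentiableAt ℝ l (∑ i, α i • c i)) (i : Fin n) :
    lineDeriv ℝ (fun α' : 𝔼 => l (∑ i, α' i • c i)) α (EuclideanSpace.single i 1) =
      fderiv ℝ l (∑ i, α i • c i) (c i) := by
  have h1 : HasFDerivAt (fun α' : 𝔼 => ∑ i, α' i • c i)
      (∑ i, (EuclideanSpace.proj (𝕜 := ℝ) i : 𝔼 →L[ℝ] ℝ).smulRight (c i)) α := by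
    refine HasFDerivAt.fun_sum fun i _ => ?_
    exact (EuclideanSpace.proj (𝕜 := ℝ) i : 𝔼 →L[ℝ] ℝ).hasFDerivAt.smul_const (c i)
  have h2 : HasFDerivAt (fun α' : 𝔼 => l (∑ i, α' i • c i)) _ α := hl.hasFDerivAt.comp α h1
  rw [h2.differentiableAt.lineDeriv_eq_fderiv, h2.fderiv]
  simp [PiLp.single_apply, ite_smul]

theorem bracketSystemOn_iff (b : Module.Basis (Fin n) ℝ (GroupLieAlgebra (𝓡 n) G))
    (hVo : IsOpen V) (hV : ∀ (g : G) (α : 𝔼), leftTriv (g, α) ∈ U ↔ α ∈ V)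
    (hind : IndependentOfBase L) (hL : ContMDiffOn (𝓡 n).tangent 𝓘(ℝ, ℝ) ∞ L U) :
    BracketSystemOn b L U ↔ ∀ α ∈ V, ∀ a : 𝔼,
      fderiv ℝ (fun α : 𝔼 => L (leftTriv ((1 : G), α))) α (modelBracket G a α) = 0 := by
  -- The same basis, seen in the model space, where `l` is differentiated.
  obtain ⟨b', hb'⟩ : ∃ b' : Module.Basis (Fin n) ℝ 𝔼, b' = b := ⟨b, rfl⟩
  have hl := contDiffOn_leftTriv_comp hV hL 1
  have hsum : ∀ (φ : OpenPartialHomeomorph G 𝔼) (x α : 𝔼), (∑ i, α i • b' i) ∈ V → ∀ a : 𝔼,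
      ∑ i, b'.repr (modelBracket G a (∑ j, α j • b' j)) i * partialAlpha φ b L i x α =
        fderiv ℝ (fun α : 𝔼 => L (leftTriv ((1 : G), α))) (∑ i, α i • b' i)
          (modelBracket G a (∑ i, α i • b' i)) := by
    intro φ x α hα a
    have hp : ∀ i, partialAlpha φ b L i x α =
        fderiv ℝ (fun α : 𝔼 => L (leftTriv ((1 : G), α))) (∑ i, α i • b' i) (b' i) := fun i => by
      rw [← lineDeriv_sum_smul
        ((hl.contDiffAt (hVo.mem_nhds hα)).differentiableAt (by simp)), partialAlpha]
      congr 1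
      funext α'
      subst hb'
      exact hind _ _ _
    -- Expanding the bracket in the basis and using linearity of `dl` yields the coordinate sum.
    conv_rhs => rw [← b'.sum_repr (modelBracket G a (∑ i, α i • b' i)), map_sum]
    exact Finset.sum_congr rfl fun i _ => by rw [hp, map_smul, smul_eq_mul]
  constructor
  · intro h α hα a
    obtain ⟨c, rfl⟩ : ∃ c : 𝔼, ∑ i, c i • b' i = α := ⟨WithLp.toLp 2 (b'.repr α), b'.sum_repr α⟩
    have h1 := hsum (chartAt 𝔼 (1 : G)) (chartAt 𝔼 (1 : G) 1) c hα a
    subst hb'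
    exact h1.symm.trans (h _ (IsManifold.chart_mem_maximalAtlas 1) _ (mem_chart_target 𝔼 (1 : G))
      c ((hV _ _).mpr hα) a)
  · intro h φ hφ x hx α hα a
    have hα' : (∑ i, α i • b' i) ∈ V := by subst hb'; exact (hV _ _).mp hα
    have h1 := (hsum φ x α hα' a).trans (h _ hα' a)
    subst hb'
    exact h1

/-! ### The base system and connectedness. -/

theorem IndependentOfBase.baseSystemOn (b : Module.Basis (Fin n) ℝ (GroupLieAlgebra (𝓡 n) G))
    (hind : IndependentOfBase L) : BaseSystemOn b L U := by
  intro φ _ x _ α _ i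
  have h : (fun x' => L (semiInvInv φ b x' α)) = fun _ => L (semiInvInv φ b x α) :=
    funext fun x' => hind _ _ _
  rw [partialX, h]
  simp [lineDeriv]

theorem isLocallyConstant_of_baseSystemOn
    (b : Module.Basis (Fin n) ℝ (GroupLieAlgebra (𝓡 n) G))
    (hV : ∀ (g : G) (α : 𝔼), leftTriv (g, α) ∈ U ↔ α ∈ V)
    (hL : ContMDiffOn (𝓡 n).tangent 𝓘(ℝ, ℝ) ∞ L U) (h : BaseSystemOn b L U) {α : 𝔼}
    (hα : α ∈ V) : IsLocallyConstant fun g : G => L (leftTriv (g, α)) := by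
  rw [IsLocallyConstant.iff_eventually_eq]
  intro g
  have hφ : chartAt 𝔼 g ∈ IsManifold.maximalAtlas (𝓡 n) ∞ G := IsManifold.chart_mem_maximalAtlas g
  have hg : g ∈ (chartAt 𝔼 g).source := mem_chart_source 𝔼 g
  set φ := chartAt 𝔼 g
  have hd := (contDiffOn_chart_symm_comp hV hL hφ hα).differentiableOn (by simp)
  have hz : ∀ x ∈ φ.target, fderiv ℝ (fun x => L (leftTriv (φ.symm x, α))) x = 0 := by
    intro x hx
    have hdx := hd.differentiableAt (φ.open_target.mem_nhds hx)
    refine ContinuousLinearMap.coe_injective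
      ((EuclideanSpace.basisFun (Fin n) ℝ).toBasis.ext fun i => ?_)
    obtain ⟨b', hb'⟩ : ∃ b' : Module.Basis (Fin n) ℝ 𝔼, b' = b := ⟨b, rfl⟩
    obtain ⟨c, hc⟩ : ∃ c : 𝔼, ∑ i, c i • b' i = α := ⟨WithLp.toLp 2 (b'.repr α), b'.sum_repr α⟩
    have hs : ∀ x', semiInvInv φ b x' c = leftTriv (φ.symm x', α) := by
      intro x'
      subst hb' hc
      rfl
    have h1 := h φ hφ x hx c (by rw [hs, hV]; exact hα) i
    simp only [partialX, hs] at h1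
    rw [hdx.lineDeriv_eq_fderiv] at h1
    simpa using h1
  -- A chart target need not be connected, so a ball in it is used.
  obtain ⟨r, hr, hball⟩ := Metric.isOpen_iff.mp φ.open_target (φ g) (φ.map_source hg)
  filter_upwards [φ.open_source.mem_nhds hg,
    (φ.continuousAt hg).preimage_mem_nhds (Metric.ball_mem_nhds _ hr)] with g' h1 h2
  have h3 := Metric.isOpen_ball.is_const_of_fderiv_eq_zero (convex_ball (φ g) r).isPreconnected
    (hd.mono hball) (fun x hx => hz x (hball hx)) h2 (Metric.mem_ball_self hr)
  simpa only [φ.left_inv h1, φ.left_inv hg] using h3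

theorem BaseSystemOn.independentOfBase [ConnectedSpace G]
    {b : Module.Basis (Fin n) ℝ (GroupLieAlgebra (𝓡 n) G)} (hV₀ : ∀ α : 𝔼, α ≠ 0 → α ∈ V)
    (hV : ∀ (g : G) (α : 𝔼), leftTriv (g, α) ∈ U ↔ α ∈ V) (hLc : Continuous L)
    (hL : ContMDiffOn (𝓡 n).tangent 𝓘(ℝ, ℝ) ∞ L U) (h : BaseSystemOn b L U) :
    IndependentOfBase L := by
  intro g g'
  -- For `n = 0` there are no nonzero vectors to approximate `0`. Charts are then injective into a
  -- point, so `G` is discrete and connectedness alone suffices.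
  rcases subsingleton_or_nontrivial 𝔼 with hs | hs
  · intro α
    have hloc : IsLocallyConstant fun g : G => L (leftTriv (g, α)) := by
      rw [IsLocallyConstant.iff_eventually_eq]
      intro g
      filter_upwards [(chartAt 𝔼 g).open_source.mem_nhds (mem_chart_source 𝔼 g)] with k hk
      rw [(chartAt 𝔼 g).injOn hk (mem_chart_source 𝔼 g) (Subsingleton.elim _ _)]
    exact hloc.apply_eq_of_preconnectedSpace g g'
  -- The zero vector may lie outside `V`; nonzero vectors are dense and `L` is continuous.
  · have hc : ∀ k : G, Continuous fun α : 𝔼 => L (leftTriv (k, α)) := fun k =>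
      hLc.comp ((contMDiff_leftTriv (n := n) (G := G)).continuous.comp (by fun_prop))
    have : NeBot (𝓝[≠] (0 : 𝔼)) := Module.punctured_nhds_neBot ℝ 𝔼 0
    exact congrFun ((hc g).ext_on (dense_compl_singleton (0 : 𝔼)) (hc g') fun α hα =>
      (isLocallyConstant_of_baseSystemOn b hV hL h (hV₀ α hα)).apply_eq_of_preconnectedSpace g g')
end

end

/-! ### Assembly of the two equivalences. -/

theorem proposition4p3 {n : ℕ} {G : Type*} [TopologicalSpace G]
    [ChartedSpace (EuclideanSpace ℝ (Fin n)) G] [Group G] [LieGroup (𝓡 n) ∞ G]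
    (b : Module.Basis (Fin n) ℝ (GroupLieAlgebra (𝓡 n) G))
    (U : Set (TangentBundle (𝓡 n) G)) (hU : U = univ ∨ U = slitTangentBundle n G)
    (L : TangentBundle (𝓡 n) G → ℝ) (hLc : Continuous L)
    (hL : ContMDiffOn (𝓡 n).tangent 𝓘(ℝ, ℝ) ∞ L U) :
    ((IsLeftInvariant L ∧ SolvesEulerLagrangeOn canonicalSpray L U) ↔
        (IndependentOfBase L ∧ BracketSystemOn b L U)) ∧
      (ConnectedSpace G →
        ((IsLeftInvariant L ∧ SolvesEulerLagrangeOn canonicalSpray L U) ↔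
          (BaseSystemOn b L U ∧ BracketSystemOn b L U))) := by
  obtain ⟨V, hVo, hV₀, hV⟩ := exists_isOpen_leftTriv_mem_iff hU
  have main : (IsLeftInvariant L ∧ SolvesEulerLagrangeOn canonicalSpray L U) ↔
      (IndependentOfBase L ∧ BracketSystemOn b L U) := by
    rw [isLeftInvariant_iff_independentOfBase]
    -- The Euler-Lagrange and bracket systems are compared only under independence of the base
    -- point, where `L` descends to `l`.
    exact and_congr_right fun hind =>
      (solvesEulerLagrangeOn_canonicalSpray_iff hVo hV hind hL).trans
        (bracketSystemOn_iff b hVo hV hind hL).symm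
  refine ⟨main, fun _ => main.trans (and_congr_left fun _ => ?_)⟩
  exact ⟨fun h => h.baseSystemOn b, fun h => h.independentOfBase hV₀ hV hLc hL⟩
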